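/- Let $\mathbb{D}$ be the open unit disk and let $H^2$ be the Hardy space: the analytic functions $f$ on $\mathbb{D}$ with $\|f\|^2=\lim_{r\to1}\int_0^{2\pi}|f(re^{i\theta})|^2\frac{d\theta}{2\pi}<\infty$. For $\psi:\mathbb{D}\to\mathbb{C}$ and $\varphi:\mathbb{D}\to\mathbb{D}$ analytic, write $C_{\psi,\varphi}f=\psi\cdot(f\circ\varphi)$ and $C_\varphi=C_{1,\varphi}$; let $(Jf)(z)=\overline{f(\overline z)}$. A conjugation on $H^2$ is an isometric antilinear involution $C$, and a bounded operator $T$ on $H^2$ is complex symmetric with conjugation $C$ if $CT^*C=T$. For $p\in\mathbb{D}\setminus\{0\}$ and $c\in\mathbb{C}$ with $|c|=1$ put $$\varphi_p(z)=\frac{\overline p}{p}\,\frac{p-z}{1-\overline p z},\qquad \psi_p(z)=c\,\frac{(1-|p|^2)^{1/2}}{1-\overline p z}.$$ Call $(\psi,\varphi)$ an admissible pair if, for some $a_0\in\mathbb{D}$ and $a_1,b\in\mathbb{C}$, $\psi(z)=\frac{b}{1-a_0z}$ and $\varphi(z)=a_0+\frac{a_1z}{1-a_0z}$, and $\varphi$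 maps $\mathbb{D}$ into itself. **Theorem 2.5.** Let $\widetilde\psi:\mathbb{D}\to\mathbb{C}$ and $\widetilde\varphi:\mathbb{D}\to\mathbb{D}$ be analytic. (1) For $p\in\mathbb{D}\setminus\{0\}$ and $|c|=1$, $C_{\psi_p,\varphi_p}J$ is a conjugation on $H^2$. If $\widetilde\psi=\psi_p\cdot(\psi\circ\varphi_p)$ and $\widetilde\varphi=\varphi\circ\varphi_p$ for some admissible pair $(\psi,\varphi)$, then $C_{\widetilde\psi,\widetilde\varphi}$ is bounded on $H^2$ and complex symmetric with conjugation $C_{\psi_p,\varphi_p}J$. Conversely, if $\widetilde\psi\not\equiv0$ and $C_{\widetilde\psi,\widetilde\varphi}$ is bounded on $H^2$ and complex symmetric with conjugation $C_{\psi_p,\varphi_p}J$, then $\widetilde\psi$ and $\widetilde\varphi$ have this form for some admissible pair $(\psi,\varphi)$. (2) For $\lambda\in\mathbb{C}$ with $|\lambda|=1$, $C_{\lambda z}J$ is a conjugation on $H^2$. If $\widetilde\psi(z)=\psi(\lambda z)$ and $\widetilde\varphi(z)=\varphi(\lambda z)$ for some admissible pair $(\psi,\varphi)$, then $C_{\widetilde\psi,\widetilde\varphi}$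 is bounded on $H^2$ and complex symmetric with conjugation $C_{\lambda z}J$. Conversely, if $\widetilde\psi\not\equiv0$ and $C_{\widetilde\psi,\widetilde\varphi}$ is bounded on $H^2$ and complex symmetric with conjugation $C_{\lambda z}J$, then $\widetilde\psi$ and $\widetilde\varphi$ have this form for some admissible pair $(\psi,\varphi)$. -/

import Mathlib

open Complex Filter Topology Metric
open scoped Complex.UnitDisc ComplexConjugate

/-- The extension of a function on the open unit disk `𝔻` to `ℂ`, by `0` off the disk. -/
noncomputable def discExtend (f : 𝔻 → ℂ) (z : ℂ) : ℂ :=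
  if h : ‖z‖ < 1 then f (UnitDisc.mk z h) else 0

theorem discExtend_coe (f : 𝔻 → ℂ) (z : 𝔻) : discExtend f z = f z := by
  simp [discExtend, z.norm_lt_one]

/-- `f` is analytic on the open unit disk. -/
def IsHolo (f : 𝔻 → ℂ) : Prop :=
  DifferentiableOn ℂ (discExtend f) (ball 0 1)

/-- The integral mean `∫₀^{2π} |f(r e^{iθ})|² dθ/2π`, for `0 ≤ r < 1`. -/
noncomputable def integralMean (f : 𝔻 → ℂ) (r : ℝ) : ℝ :=
  Real.circleAverage (fun z => ‖discExtend f z‖ ^ 2) 0 r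

/-- `f` belongs to the Hardy space: it is analytic on the disk, and its integral means have a
finite limit as `r → 1`. -/
def MemHardy (f : 𝔻 → ℂ) : Prop :=
  IsHolo f ∧ ∃ L : ℝ, Tendsto (integralMean f) (𝓝[<] 1) (𝓝 L)

/-- The Taylor coefficients at the origin. -/
noncomputable def taylorCoeff (f : 𝔻 → ℂ) (n : ℕ) : ℂ :=
  (n.factorial : ℂ)⁻¹ * iteratedDeriv n (discExtend f) 0

theorem IsHolo.hasSum {f : 𝔻 → ℂ} (hf : IsHolo f) (z : 𝔻) :
    HasSum (fun n => taylorCoeff f n * (z : ℂ) ^ n) (f z) := by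
  have h := hasSum_taylorSeries_on_ball (r := 1) hf (z := (z : ℂ)) (by simpa using z.norm_lt_one)
  rw [discExtend_coe] at h
  refine h.congr_fun ?_ 
  intro n
  simp [taylorCoeff]; ring

theorem summable_norm_of_hasSum {f : 𝔻 → ℂ} {a : ℕ → ℂ}
    (h : ∀ z : 𝔻, HasSum (fun n => a n * (z : ℂ) ^ n) (f z)) {r : ℝ} (h0 : 0 ≤ r) (h1 : r < 1) :
    Summable fun n => ‖a n‖ * r ^ n := by
  have := (h (UnitDisc.mk (r : ℂ) (by simpa [abs_of_nonneg h0] using h1))).summable.norm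
  simpa [abs_of_nonneg h0] using this

theorem hasFPowerSeries_of_hasSum {f : 𝔻 → ℂ} {a : ℕ → ℂ}
    (h : ∀ z : 𝔻, HasSum (fun n => a n * (z : ℂ) ^ n) (f z)) :
    HasFPowerSeriesOnBall (discExtend f) (FormalMultilinearSeries.ofScalars ℂ a) 0 1 where
  r_le := by
    refine ENNReal.le_of_forall_nnreal_lt fun r hr => ?_
    refine FormalMultilinearSeries.le_radius_of_summable _ ?_
    have hr1 : (r : ℝ) < 1 := by exact_mod_cast hr
    simpa using summable_norm_of_hasSum h r.2 hr1
  r_pos := one_pos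
  hasSum := by
    intro y hy
    have hy1 : ‖y‖ < 1 := by
      simpa [← ENNReal.ofReal_one, edist_dist] using hy
    have := h (UnitDisc.mk y hy1)
    rw [← discExtend_coe f] at this
    simpa [FormalMultilinearSeries.ofScalars_apply_eq, mul_comm] using this

theorem isHolo_of_hasSum {f : 𝔻 → ℂ} {a : ℕ → ℂ}
    (h : ∀ z : 𝔻, HasSum (fun n => a n * (z : ℂ) ^ n) (f z)) : IsHolo f := by
  have := (hasFPowerSeries_of_hasSum h).differentiableOn
  rwa [← ENNReal.ofReal_one, Metric.eball_ofReal] at this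

theorem taylorCoeff_of_hasSum {f : 𝔻 → ℂ} {a : ℕ → ℂ}
    (h : ∀ z : 𝔻, HasSum (fun n => a n * (z : ℂ) ^ n) (f z)) : taylorCoeff f = a := by
  have h1 := (hasFPowerSeries_of_hasSum h).hasFPowerSeriesAt
  have h2 := (hasFPowerSeries_of_hasSum (isHolo_of_hasSum h).hasSum).hasFPowerSeriesAt
  have h3 := h2.eq_formalMultilinearSeries h1
  exact FormalMultilinearSeries.ofScalars_series_injective ℂ ℂ h3

theorem hasSum_integralMean {f : 𝔻 → ℂ} {a : ℕ → ℂ}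
    (h : ∀ z : 𝔻, HasSum (fun n => a n * (z : ℂ) ^ n) (f z)) {r : ℝ} (h0 : 0 ≤ r) (h1 : r < 1) :
    HasSum (fun n => ‖a n‖ ^ 2 * (r ^ 2) ^ n) (integralMean f r) := by
  rw [hasSum_iff_tendsto_nat_of_nonneg (fun n => by positivity)]
  set p : ℕ → Polynomial ℂ := fun N => ∑ n ∈ Finset.range N,
    Polynomial.monomial n (a n * (r : ℂ) ^ n)
  have hp : ∀ N, ∑ n ∈ Finset.range N, ‖a n‖ ^ 2 * (r ^ 2) ^ n
      = Real.circleAverage (fun z => ‖(p N).eval z‖ ^ 2) 0 1 := by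
    intro N
    rw [← Polynomial.sum_sq_norm_coeff_eq_circleAverage]
    have hc : ∀ i, (p N).coeff i = if i < N then a i * (r : ℂ) ^ i else 0 := by
      intro i
      simp [p, Polynomial.finsetSum_coeff, Polynomial.coeff_monomial]
    symm
    rw [Finset.sum_subset (s₂ := Finset.range N)]
    · refine Finset.sum_congr rfl fun i hi => ?_
      rw [hc, if_pos (Finset.mem_range.1 hi)]
      simp [mul_pow, abs_of_nonneg h0]; left; ring
    · intro i hi
      by_contra hcon
      rw [Finset.mem_range] at hcon
      simp [hc, hcon] at hi
    · intro i _ hi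
      simp at hi
      simp [hi]
  simp_rw [hp]
  unfold integralMean Real.circleAverage
  refine Tendsto.const_smul ?_ _
  have hs := summable_norm_of_hasSum h h0 h1
  refine intervalIntegral.tendsto_integral_filter_of_dominated_convergence
    (fun _ => (∑' n, ‖a n‖ * r ^ n) ^ 2) ?_ ?_ ?_ ?_
  · refine Eventually.of_forall fun N => ?_
    refine Continuous.aestronglyMeasurable ?_
    have : Continuous fun z : ℂ => (p N).eval z := (p N).continuous
    exact ((this.comp (continuous_circleMap 0 1)).norm.pow 2)
  · refine Eventually.of_forall fun N => Eventually.of_forall fun θ _ => ?_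
    rw [Real.norm_of_nonneg (by positivity)]
    refine pow_le_pow_left₀ (norm_nonneg _) ?_ 2
    calc ‖(p N).eval (circleMap 0 1 θ)‖ ≤ ∑ n ∈ Finset.range N, ‖a n‖ * r ^ n := by
          simp only [p, Polynomial.eval_finsetSum, Polynomial.eval_monomial]
          refine (norm_sum_le _ _).trans (Finset.sum_le_sum fun i _ => ?_)
          simp [abs_of_nonneg h0]
      _ ≤ _ := hs.sum_le_tsum _ (fun i _ => by positivity)
  · exact intervalIntegrable_const
  · refine Eventually.of_forall fun θ _ => ?_
    have hz : ‖circleMap 0 r θ‖ < 1 := by simpa [abs_of_nonneg h0] using h1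
    have := (h (UnitDisc.mk _ hz)).tendsto_sum_nat
    rw [← discExtend_coe f] at this
    refine (this.norm.pow 2).congr fun N => ?_
    simp [p, Polynomial.eval_finsetSum, circleMap, mul_pow, mul_assoc]

theorem tendsto_integralMean {f : 𝔻 → ℂ} {a : ℕ → ℂ}
    (h : ∀ z : 𝔻, HasSum (fun n => a n * (z : ℂ) ^ n) (f z)) (ha : Summable fun n => ‖a n‖ ^ 2) :
    Tendsto (integralMean f) (𝓝[<] 1) (𝓝 (∑' n, ‖a n‖ ^ 2)) := by
  have hev : ∀ᶠ r : ℝ in 𝓝[<] 1, 0 < r ∧ r < 1 :=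
    Ioo_mem_nhdsLT (zero_lt_one)
  have : Tendsto (fun r : ℝ => ∑' n, ‖a n‖ ^ 2 * (r ^ 2) ^ n) (𝓝[<] 1) (𝓝 (∑' n, ‖a n‖ ^ 2)) := by
    refine tendsto_tsum_of_dominated_convergence ha ?_ ?_
    · intro k
      have : Continuous fun r : ℝ => ‖a k‖ ^ 2 * (r ^ 2) ^ k := by fun_prop
      have := this.tendsto 1
      simp only [one_pow, mul_one] at this
      exact this.mono_left nhdsWithin_le_nhds
    · filter_upwards [hev] with r hr k
      rw [Real.norm_of_nonneg (by positivity)]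
      exact mul_le_of_le_one_right (by positivity)
        (pow_le_one₀ (by positivity) (pow_le_one₀ hr.1.le hr.2.le))
  refine this.congr' ?_
  filter_upwards [hev] with r hr
  exact (hasSum_integralMean h hr.1.le hr.2).tsum_eq

theorem summable_of_tendsto {f : 𝔻 → ℂ} {a : ℕ → ℂ}
    (h : ∀ z : 𝔻, HasSum (fun n => a n * (z : ℂ) ^ n) (f z)) {L : ℝ}
    (hL : Tendsto (integralMean f) (𝓝[<] 1) (𝓝 L)) : Summable fun n => ‖a n‖ ^ 2 := by
  have hev : ∀ᶠ r : ℝ in 𝓝[<] 1, 0 < r ∧ r < 1 :=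
    Ioo_mem_nhdsLT (zero_lt_one)
  refine summable_of_sum_range_le (c := L) (fun n => by positivity) fun N => ?_
  have hc : Continuous fun r : ℝ => ∑ n ∈ Finset.range N, ‖a n‖ ^ 2 * (r ^ 2) ^ n := by fun_prop
  have hc1 := (hc.tendsto 1).mono_left (nhdsWithin_le_nhds (s := Set.Iio 1))
  simp only [one_pow, mul_one] at hc1
  refine le_of_tendsto_of_tendsto hc1 hL ?_
  filter_upwards [hev] with r hr
  have hs := hasSum_integralMean h hr.1.le hr.2
  exact sum_le_hasSum _ (fun i _ => by positivity) hs

theorem memHardy_iff {f : 𝔻 → ℂ} {a : ℕ → ℂ}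
    (h : ∀ z : 𝔻, HasSum (fun n => a n * (z : ℂ) ^ n) (f z)) : MemHardy f ↔ Memℓp a 2 := by
  rw [memℓp_gen_iff (by norm_num)]
  norm_num
  exact ⟨fun hf => summable_of_tendsto h hf.2.choose_spec,
    fun ha => ⟨isHolo_of_hasSum h, _, tendsto_integralMean h ha⟩⟩

theorem MemHardy.memℓp {f : 𝔻 → ℂ} (hf : MemHardy f) : Memℓp (taylorCoeff f) 2 :=
  (memHardy_iff hf.1.hasSum).1 hf

theorem hasSum_add_aux {f g : 𝔻 → ℂ} (hf : IsHolo f) (hg : IsHolo g) (z : 𝔻) :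
    HasSum (fun n => (taylorCoeff f + taylorCoeff g) n * (z : ℂ) ^ n) ((f + g) z) := by
  simpa [add_mul] using (hf.hasSum z).add (hg.hasSum z)

theorem hasSum_smul_aux {f : 𝔻 → ℂ} (c : ℂ) (hf : IsHolo f) (z : 𝔻) :
    HasSum (fun n => (c • taylorCoeff f) n * (z : ℂ) ^ n) ((c • f) z) := by
  simpa [mul_assoc] using (hf.hasSum z).mul_left c

/-- The Hardy space as a linear subspace of the functions on the disk. -/
def hardySubmodule : Submodule ℂ (𝔻 → ℂ) where
  carrier := {f | MemHardy f}
  add_mem' {f g} hf hg := (memHardy_iff (hasSum_add_aux hf.1 hg.1)).2 (hf.memℓp.add hg.memℓp)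
  zero_mem' := (memHardy_iff (a := 0) (by simp)).2 zero_memℓp
  smul_mem' c f hf := (memHardy_iff (hasSum_smul_aux c hf.1)).2 (hf.memℓp.const_smul c)

/-- The Hardy space `H²` of the open unit disk. -/
def HardySpace : Type := hardySubmodule

namespace HardySpace

noncomputable instance : AddCommGroup HardySpace := inferInstanceAs (AddCommGroup hardySubmodule)

noncomputable instance : Module ℂ HardySpace := inferInstanceAs (Module ℂ hardySubmodule)

/-- An element of `H²` as a function on the disk. -/
instance : CoeFun HardySpace (fun _ => 𝔻 → ℂ) := ⟨fun f => f.1⟩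

/-- The sequence of Taylor coefficients, as a linear map into `ℓ²`. -/
noncomputable def coeffMap : HardySpace →ₗ[ℂ] lp (fun _ : ℕ => ℂ) 2 where
  toFun f := ⟨taylorCoeff f, f.2.memℓp⟩
  map_add' f g := Subtype.ext (taylorCoeff_of_hasSum (hasSum_add_aux f.2.1 g.2.1))
  map_smul' c f := Subtype.ext (taylorCoeff_of_hasSum (hasSum_smul_aux c f.2.1))

theorem coeffMap_injective : Function.Injective coeffMap := by
  intro f g h
  have h' : taylorCoeff f = taylorCoeff g := congrArg Subtype.val h
  refine Subtype.ext (funext fun z => ?_)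
  have hf := f.2.1.hasSum z
  rw [h'] at hf
  exact hf.unique (g.2.1.hasSum z)

theorem coeffMap_surjective : Function.Surjective coeffMap := by
  intro a
  have hs : ∀ z : 𝔻, HasSum (fun n => a n * (z : ℂ) ^ n) (∑' n, a n * (z : ℂ) ^ n) := by
    intro z
    refine Summable.hasSum (Summable.of_norm ?_)
    refine Summable.of_nonneg_of_le (fun n => norm_nonneg _) (fun n => ?_)
      ((summable_geometric_of_lt_one (norm_nonneg _) z.norm_lt_one).mul_left ‖a‖)
    rw [norm_mul, norm_pow]
    gcongr
    exact lp.norm_apply_le_norm (by norm_num) a n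
  exact ⟨⟨fun z => ∑' n, a n * (z : ℂ) ^ n, (memHardy_iff hs).2 (lp.memℓp a)⟩,
    Subtype.ext (taylorCoeff_of_hasSum hs)⟩

/-- The Taylor coefficients identify `H²` linearly with the square-summable sequences. -/
noncomputable def coeffEquiv : HardySpace ≃ₗ[ℂ] lp (fun _ : ℕ => ℂ) 2 :=
  LinearEquiv.ofBijective coeffMap ⟨coeffMap_injective, coeffMap_surjective⟩

/-- The norm of `H²`, transported from the Taylor coefficients: its square is the limit of the
integral means, as `tendsto_integralMean_norm_sq` below shows. -/
noncomputable instance : NormedAddCommGroup HardySpace :=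
  NormedAddCommGroup.induced HardySpace (lp (fun _ : ℕ => ℂ) 2) coeffEquiv coeffEquiv.injective

theorem norm_def (f : HardySpace) : ‖f‖ = ‖coeffEquiv f‖ := rfl

/-- The inner product `⟪f, g⟫ = ∑ conj (aₙ) bₙ` that belongs to this norm. -/
noncomputable instance : InnerProductSpace ℂ HardySpace where
  norm_smul_le c f := by
    rw [norm_def, norm_def, map_smul]; exact norm_smul_le _ _
  inner f g := inner ℂ (coeffEquiv f) (coeffEquiv g)
  norm_sq_eq_re_inner f := norm_sq_eq_re_inner (𝕜 := ℂ) (coeffEquiv f)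
  conj_inner_symm f g := inner_conj_symm (𝕜 := ℂ) (coeffEquiv f) (coeffEquiv g)
  add_left f g h := by
    rw [map_add]; exact inner_add_left _ _ _
  smul_left f g c := by
    rw [map_smul]; exact inner_smul_left _ _ _

instance : CompleteSpace HardySpace := by
  let e : HardySpace ≃ₗᵢ[ℂ] lp (fun _ : ℕ => ℂ) 2 := ⟨coeffEquiv, fun f => (norm_def f).symm⟩
  exact (completeSpace_congr (e := e.toEquiv) e.isometry.isUniformEmbedding).2 inferInstance

/-- The Hilbert space norm is the one given by the limit of the integral means. -/
theorem tendsto_integralMean_norm_sq (f : HardySpace) :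
    Tendsto (integralMean f) (𝓝[<] 1) (𝓝 (‖f‖ ^ 2)) := by
  have h : ‖f‖ ^ 2 = ∑' n, ‖taylorCoeff (f : 𝔻 → ℂ) n‖ ^ 2 := by
    have := lp.norm_rpow_eq_tsum (p := 2) (by norm_num) (coeffEquiv f)
    rw [norm_def]
    norm_num at this
    exact this
  have hs := (memℓp_gen_iff (by norm_num)).1 f.2.memℓp
  norm_num at hs
  rw [h]
  exact tendsto_integralMean f.2.1.hasSum hs

end HardySpace

/-- The weighted composition `C_{ψ,φ} f = ψ · (f ∘ φ)`. -/
def weightedComp (ψ : 𝔻 → ℂ) (φ : 𝔻 → 𝔻) (f : 𝔻 → ℂ) : 𝔻 → ℂ :=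
  fun z => ψ z * f (φ z)

/-- `(J f)(z) = conj (f (conj z))`. -/
noncomputable def conjJ (f : 𝔻 → ℂ) : 𝔻 → ℂ :=
  fun z => conj (f (star z))

/-- A conjugation on a complex Hilbert space: an isometric antilinear involution. -/
def IsConjugation {H : Type*} [NormedAddCommGroup H] [InnerProductSpace ℂ H]
    (C : H →ₗᵢ⋆[ℂ] H) : Prop :=
  Function.Involutive C

/-- The bounded operator `T` is complex symmetric with conjugation `C`: `C T* C = T`. -/
def IsComplexSymmetric {H : Type*} [NormedAddCommGroup H] [InnerProductSpace ℂ H]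
    [CompleteSpace H] (T : H →L[ℂ] H) (C : H →ₗᵢ⋆[ℂ] H) : Prop :=
  IsConjugation C ∧ ∀ f, C (ContinuousLinearMap.adjoint T (C f)) = T f

/-- `C_{ψ,φ}` is a bounded operator on `H²`, complex symmetric with conjugation `C`. -/
def WeightedCompIsSymmetric (ψ : 𝔻 → ℂ) (φ : 𝔻 → 𝔻)
    (C : HardySpace →ₗᵢ⋆[ℂ] HardySpace) : Prop :=
  ∃ T : HardySpace →L[ℂ] HardySpace,
    (∀ f : HardySpace, (T f : 𝔻 → ℂ) = weightedComp ψ φ f) ∧ IsComplexSymmetric T C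

theorem norm_mobius_lt_one (p z : 𝔻) :
    ‖conj (p : ℂ) / p * ((p - z) / (1 - conj (p : ℂ) * z))‖ < 1 := by
  have hp := p.normSq_lt_one
  have hz := z.normSq_lt_one
  have key : normSq ((p : ℂ) - z) < normSq (1 - conj (p : ℂ) * z) := by
    have : normSq (1 - conj (p : ℂ) * z) - normSq ((p : ℂ) - z)
        = (1 - normSq (p : ℂ)) * (1 - normSq (z : ℂ)) := by
      simp [normSq_apply]; ring
    nlinarith [mul_pos (sub_pos.2 hp) (sub_pos.2 hz)]
  have h1 : ‖((p : ℂ) - z) / (1 - conj (p : ℂ) * z)‖ < 1 := by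
    have hpos : 0 < ‖1 - conj (p : ℂ) * z‖ := by
      rw [norm_pos_iff, ← normSq_pos]
      exact (normSq_nonneg _).trans_lt key
    rw [norm_div, div_lt_one hpos]
    rw [← Complex.sq_norm, ← Complex.sq_norm] at key
    exact lt_of_pow_lt_pow_left₀ 2 hpos.le key
  rw [norm_mul]
  refine mul_lt_one_of_nonneg_of_lt_one_right ?_ (norm_nonneg _) h1
  rw [norm_div, norm_conj]
  exact div_self_le_one _

/-- The automorphism `φ_p(z) = (conj p / p) (p - z) / (1 - conj p z)` of the disk; it is used
for `p ≠ 0` only. -/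
noncomputable def phiP (p z : 𝔻) : 𝔻 :=
  UnitDisc.mk (conj (p : ℂ) / p * ((p - z) / (1 - conj (p : ℂ) * z))) (norm_mobius_lt_one p z)

/-- `ψ_p(z) = c (1 - |p|²)^{1/2} / (1 - conj p z)`, where `|c| = 1`. -/
noncomputable def psiP (c : ℂ) (p z : 𝔻) : ℂ :=
  c * (Real.sqrt (1 - ‖(p : ℂ)‖ ^ 2) / (1 - conj (p : ℂ) * z))

/-- The symbols `ψ(z) = b / (1 - a₀ z)` and `φ(z) = a₀ + a₁ z / (1 - a₀ z)` with `a₀ ∈ 𝔻`,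
where `φ` is a self-map of the disk. -/
def IsJSymbolPair (ψ : 𝔻 → ℂ) (φ : 𝔻 → 𝔻) : Prop :=
  ∃ (a₀ : 𝔻) (a₁ b : ℂ), (∀ z : 𝔻, ψ z = b / (1 - a₀ * z)) ∧
    ∀ z : 𝔻, (φ z : ℂ) = a₀ + a₁ * z / (1 - a₀ * z)

/-! Both parts are one statement about `C = C_{σ,τ} J`, with `(σ, τ)` equal to `(ψ_p, φ_p)` or to
`(1, λz)`. Two identities are used: `τ` followed by conjugation is an involution of the disk, and `σ
· conj (σ ∘ star ∘ τ) = 1`. They give `C² = 1`, and a contractive involution is isometric.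

Complex symmetry is tested on the reproducing kernels: `C T* C = T` makes `(C T K_u)(v)` symmetric
in `u` and `v`. Writing `T = C_{σ,τ} C_{ψ,φ}`, one has `C T = J C_{ψ,φ}`, so `σ` and `τ` drop out
and the condition becomes the symmetry of `ψ(v) / (1 - u φ(v))`. Admissible pairs satisfy it
(`weightedComp_kernel_symm`), and it has no other nonzero solutions (`isJSymbolPair_of_symm`).

Boundedness is a form of Littlewood subordination, `exists_kernel_weightedComp`: if `φ(q) = 0`, then
`K_q` is orthogonal to the range of multiplication by `φ`, which controls the norm of `∑ aₙ φⁿ K_q`.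
-/

theorem isHolo_of_eq {f : 𝔻 → ℂ} {F : ℂ → ℂ} (hF : DifferentiableOn ℂ F (ball 0 1))
    (h : ∀ z : 𝔻, f z = F z) : IsHolo f := by
  refine hF.congr fun z hz => ?_
  have hz1 : ‖z‖ < 1 := by simpa using hz
  rw [discExtend, dif_pos hz1, h, UnitDisc.coe_mk]

theorem IsHolo.mul {f g : 𝔻 → ℂ} (hf : IsHolo f) (hg : IsHolo g) :
    IsHolo (fun z => f z * g z) :=
  isHolo_of_eq (DifferentiableOn.mul hf hg) fun z => by simp [discExtend_coe]

theorem IsHolo.comp {f : 𝔻 → ℂ} {φ : 𝔻 → 𝔻} (hf : IsHolo f) (hφ : IsHolo fun z => (φ z : ℂ)) :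
    IsHolo (fun z => f (φ z)) := by
  refine isHolo_of_eq (DifferentiableOn.comp (t := ball (0 : ℂ) 1) (g := discExtend f) hf hφ fun z hz => ?_) fun z => ?_
  · have hz1 : ‖z‖ < 1 := by simpa using hz
    simpa [discExtend, hz1] using (φ _).norm_lt_one
  · simp [discExtend_coe]

theorem IsHolo.continuous_discExtend_circleMap {f : 𝔻 → ℂ} (hf : IsHolo f) {r : ℝ} (h0 : 0 ≤ r)
    (h1 : r < 1) : Continuous fun θ => discExtend f (circleMap 0 r θ) :=
  hf.continuousOn.comp_continuous (continuous_circleMap 0 r) fun θ => by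
    simpa [abs_of_nonneg h0] using h1

/-- Replaces the existence of a limit by a uniform bound: each partial sum of `∑ ‖aₙ‖² r^{2n}` is
continuous in `r`, so the bound survives `r → 1`. -/
theorem memHardy_of_integralMean_le {f : 𝔻 → ℂ} (hf : IsHolo f) {L : ℝ}
    (hL : ∀ r : ℝ, 0 < r → r < 1 → integralMean f r ≤ L) : MemHardy f := by
  rw [memHardy_iff hf.hasSum, memℓp_gen_iff (by norm_num)]
  norm_num
  refine summable_of_sum_range_le (c := L) (fun n => by positivity) fun N => ?_
  have hc : Continuous fun r : ℝ =>
      ∑ n ∈ Finset.range N, ‖taylorCoeff f n‖ ^ 2 * (r ^ 2) ^ n := by fun_prop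
  have hc1 := (hc.tendsto 1).mono_left (nhdsWithin_le_nhds (s := Set.Iio 1))
  simp only [one_pow, mul_one] at hc1
  refine le_of_tendsto hc1 ?_
  filter_upwards [Ioo_mem_nhdsLT (zero_lt_one' ℝ)] with r hr
  exact (sum_le_hasSum _ (fun i _ => by positivity)
    (hasSum_integralMean hf.hasSum hr.1.le hr.2)).trans (hL r hr.1 hr.2)

theorem integralMean_mul_le {h f : 𝔻 → ℂ} (hh : IsHolo h) (hf : IsHolo f) {B : ℝ}
    (hB : ∀ z, ‖h z‖ ≤ B) {r : ℝ} (h0 : 0 ≤ r) (h1 : r < 1) :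
    integralMean (fun z => h z * f z) r ≤ B ^ 2 * integralMean f r := by
  unfold integralMean
  rw [← smul_eq_mul, ← Real.circleAverage_fun_smul]
  refine Real.circleAverage_mono ?_ ?_ fun z hz => ?_
  · exact (((hh.mul hf).continuous_discExtend_circleMap h0 h1).norm.pow 2).intervalIntegrable _ _
  · exact (((hf.continuous_discExtend_circleMap h0 h1).norm.pow 2).const_smul (B ^ 2)).intervalIntegrable _ _
  · have hz1 : ‖z‖ < 1 := by
      rw [mem_sphere_zero_iff_norm, abs_of_nonneg h0] at hz
      exact hz ▸ h1
    simp only [discExtend, dif_pos hz1, norm_mul, mul_pow, smul_eq_mul]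
    gcongr
    exact hB _

/-! ### Reproducing kernels and multiplication operators -/

namespace HardySpace

theorem ext {f g : HardySpace} (h : ∀ z, f z = g z) : f = g := Subtype.ext (funext h)

theorem add_apply (f g : HardySpace) (z : 𝔻) : (f + g) z = f z + g z := rfl

theorem smul_apply (c : ℂ) (f : HardySpace) (z : 𝔻) : (c • f) z = c * f z := rfl

theorem hasSum_norm_sq (f : HardySpace) :
    HasSum (fun n => ‖taylorCoeff (f : 𝔻 → ℂ) n‖ ^ 2) (‖f‖ ^ 2) := by
  have hs := (memℓp_gen_iff (by norm_num)).1 f.2.memℓp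
  norm_num at hs
  have := tendsto_nhds_unique (tendsto_integralMean f.2.1.hasSum hs) (tendsto_integralMean_norm_sq f)
  exact this ▸ hs.hasSum

theorem integralMean_le_norm_sq (f : HardySpace) {r : ℝ} (h0 : 0 ≤ r) (h1 : r < 1) :
    integralMean f r ≤ ‖f‖ ^ 2 :=
  hasSum_le (fun n => mul_le_of_le_one_right (by positivity)
    (pow_le_one₀ (by positivity) (pow_le_one₀ h0 h1.le)))
    (hasSum_integralMean f.2.1.hasSum h0 h1) f.hasSum_norm_sq

/-- The reproducing kernel `K_w(z) = 1 / (1 - conj w z)` of `H²`. -/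
noncomputable def kernel (w : 𝔻) : HardySpace :=
  ⟨fun z => (1 - conj (w : ℂ) * z)⁻¹, by
    have h (z : 𝔻) : HasSum (fun n => conj (w : ℂ) ^ n * (z : ℂ) ^ n)
        (1 - conj (w : ℂ) * z)⁻¹ := by
      simp_rw [← mul_pow]
      refine hasSum_geometric_of_norm_lt_one ?_
      simpa using (w * z).norm_lt_one
    refine (memHardy_iff h).2 ?_
    rw [memℓp_gen_iff (by norm_num)]
    norm_num
    simp_rw [pow_right_comm _ _ 2]
    refine summable_geometric_of_lt_one (by positivity) (by simpa using w.norm_lt_one) ⟩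

theorem kernel_apply (w z : 𝔻) : kernel w z = (1 - conj (w : ℂ) * z)⁻¹ := rfl

theorem taylorCoeff_kernel (w : 𝔻) : taylorCoeff (kernel w) = fun n => conj (w : ℂ) ^ n := by
  refine taylorCoeff_of_hasSum fun z => ?_
  simp_rw [← mul_pow]
  exact hasSum_geometric_of_norm_lt_one (by simpa using (w * z).norm_lt_one)

theorem hasSum_inner (f g : HardySpace) :
    HasSum (fun n => conj (taylorCoeff f n) * taylorCoeff g n) (inner ℂ f g) := by
  have := lp.hasSum_inner (𝕜 := ℂ) (coeffEquiv f) (coeffEquiv g)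
  simp only [RCLike.inner_apply, mul_comm] at this ⊢
  exact this

theorem inner_kernel (w : 𝔻) (f : HardySpace) : inner ℂ (kernel w) f = f w := by
  refine (hasSum_inner (kernel w) f).unique ?_
  simpa [taylorCoeff_kernel, mul_comm] using f.2.1.hasSum w

theorem kernel_apply_ne_zero (w z : 𝔻) : 1 - conj (w : ℂ) * z ≠ 0 := by
  intro h
  have := (star w * z).coe_ne_one
  simp at this
  exact this (sub_eq_zero.1 h).symm

theorem exists_clm_of_bound {ψ : 𝔻 → ℂ} {φ : 𝔻 → 𝔻} {K : ℝ}
    (h : ∀ f : HardySpace, ∃ g : HardySpace, (g : 𝔻 → ℂ) = weightedComp ψ φ f ∧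
      ‖g‖ ≤ K * ‖f‖) :
    ∃ T : HardySpace →L[ℂ] HardySpace,
      (∀ f : HardySpace, (T f : 𝔻 → ℂ) = weightedComp ψ φ f) ∧ ∀ f, ‖T f‖ ≤ K * ‖f‖ := by
  choose T hT hK using h
  refine ⟨LinearMap.mkContinuous ⟨⟨T, fun f g => ext fun z => ?_⟩, fun c f => ext fun z => ?_⟩ K hK,
    hT, hK⟩
  · simp only [add_apply, hT, weightedComp, mul_add]
  · simp only [smul_apply, hT, weightedComp, RingHom.id_apply]
    ring

theorem exists_mul {h : 𝔻 → ℂ} (hh : IsHolo h) {B : ℝ} (h0 : 0 ≤ B) (hB : ∀ z, ‖h z‖ ≤ B) :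
    ∃ T : HardySpace →L[ℂ] HardySpace,
      (∀ f : HardySpace, (T f : 𝔻 → ℂ) = weightedComp h id f) ∧ ∀ f, ‖T f‖ ≤ B * ‖f‖ := by
  refine exists_clm_of_bound fun f => ?_
  have hle (r : ℝ) (hr0 : 0 < r) (hr1 : r < 1) :
      integralMean (weightedComp h id f) r ≤ (B * ‖f‖) ^ 2 := by
    refine (integralMean_mul_le hh f.2.1 hB hr0.le hr1).trans ?_
    rw [mul_pow]
    gcongr
    exact f.integralMean_le_norm_sq hr0.le hr1
  let g : HardySpace := ⟨weightedComp h id f, memHardy_of_integralMean_le (hh.mul f.2.1) hle⟩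
  refine ⟨g, rfl, le_of_sq_le_sq ?_ (by positivity)⟩
  refine le_of_tendsto (tendsto_integralMean_norm_sq g) ?_
  filter_upwards [Ioo_mem_nhdsLT (zero_lt_one' ℝ)] with r hr
  exact hle r hr.1 hr.2

end HardySpace

/-! ### Orbits of a contraction -/

/-- If `M` is a contraction and `e` is orthogonal to its range, then the orbit `Mⁿ e` satisfies a
Bessel-type upper bound. -/
theorem norm_sq_sum_range_orbit_le {H : Type*} [NormedAddCommGroup H] [InnerProductSpace ℂ H]
    {M : H →L[ℂ] H} (hM : ∀ x, ‖M x‖ ≤ ‖x‖) {e : H} (he : ∀ x, inner ℂ e (M x) = 0) (N : ℕ)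
    (a : ℕ → ℂ) :
    ‖∑ n ∈ Finset.range N, a n • (M ^ n) e‖ ^ 2 ≤ ‖e‖ ^ 2 * ∑ n ∈ Finset.range N, ‖a n‖ ^ 2 := by
  induction N generalizing a with
  | zero => simp
  | succ N ih =>
    -- All terms but the zeroth lie in the range of `M`, hence are orthogonal to `e`; Pythagoras and
    -- contractivity reduce to the shifted coefficients.
    have hsplit : ∑ n ∈ Finset.range (N + 1), a n • (M ^ n) e
        = a 0 • e + M (∑ n ∈ Finset.range N, a (n + 1) • (M ^ n) e) := by
      rw [Finset.sum_range_succ', add_comm, map_sum]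
      simp [pow_succ']
    rw [hsplit, sq, norm_add_sq_eq_norm_sq_add_norm_sq_of_inner_eq_zero (𝕜 := ℂ) _ _
      (by rw [inner_smul_left, he, mul_zero]), Finset.sum_range_succ', mul_add, ← sq, ← sq,
      norm_smul, mul_pow]
    have h1 := pow_le_pow_left₀ (norm_nonneg _)
      (hM (∑ n ∈ Finset.range N, a (n + 1) • (M ^ n) e)) 2
    linarith [ih fun n => a (n + 1)]

theorem norm_sq_sum_orbit_le {H : Type*} [NormedAddCommGroup H] [InnerProductSpace ℂ H]
    {M : H →L[ℂ] H} (hM : ∀ x, ‖M x‖ ≤ ‖x‖) {e : H} (he : ∀ x, inner ℂ e (M x) = 0)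
    (s : Finset ℕ) (a : ℕ → ℂ) :
    ‖∑ n ∈ s, a n • (M ^ n) e‖ ^ 2 ≤ ‖e‖ ^ 2 * ∑ n ∈ s, ‖a n‖ ^ 2 := by
  obtain ⟨N, hN⟩ := s.exists_nat_subset_range
  have h := norm_sq_sum_range_orbit_le hM he N fun n => if n ∈ s then a n else 0
  rwa [← Finset.sum_subset hN fun n _ hn => by simp [hn],
    ← Finset.sum_subset hN fun n _ hn => by simp [hn],
    Finset.sum_congr rfl fun n hn => by rw [if_pos hn],
    Finset.sum_congr (g := fun n => ‖a n‖ ^ 2) rfl fun n hn => by rw [if_pos hn]] at h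

theorem exists_hasSum_orbit {H : Type*} [NormedAddCommGroup H] [InnerProductSpace ℂ H]
    [CompleteSpace H] {M : H →L[ℂ] H} (hM : ∀ x, ‖M x‖ ≤ ‖x‖) {e : H}
    (he : ∀ x, inner ℂ e (M x) = 0) {a : ℕ → ℂ} {L : ℝ} (hL0 : 0 ≤ L)
    (ha : HasSum (fun n => ‖a n‖ ^ 2) (L ^ 2)) :
    ∃ x, HasSum (fun n => a n • (M ^ n) e) x ∧ ‖x‖ ≤ ‖e‖ * L := by
  have hs : Summable fun n => a n • (M ^ n) e := by
    rw [summable_iff_vanishing_norm]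
    intro ε hε
    have hb := (ha.mul_left (‖e‖ ^ 2)).summable
    obtain ⟨s, hs⟩ := summable_iff_vanishing_norm.1 hb (ε ^ 2) (by positivity)
    refine ⟨s, fun t ht => lt_of_pow_lt_pow_left₀ 2 hε.le ?_⟩
    refine (norm_sq_sum_orbit_le hM he t a).trans_lt ?_
    rw [Finset.mul_sum]
    exact (Real.le_norm_self _).trans_lt (hs t ht)
  refine ⟨_, hs.hasSum, le_of_sq_le_sq ?_ (by positivity)⟩
  rw [mul_pow]
  refine le_of_tendsto_of_tendsto' (hs.hasSum.norm.pow 2) (ha.mul_left (‖e‖ ^ 2)) fun s => ?_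
  rw [← Finset.mul_sum]
  exact norm_sq_sum_orbit_le hM he s a

/-! ### Boundedness of weighted composition operators -/

namespace HardySpace

/-- Point evaluation is the inner product with a kernel, hence continuous. -/
theorem HasSum.apply {ι : Type*} {F : ι → HardySpace} {f : HardySpace} (h : HasSum F f) (z : 𝔻) :
    HasSum (fun i => F i z) (f z) := by
  simpa [innerSL_apply_apply, inner_kernel] using h.mapL (innerSL ℂ (kernel z))

/-- If the self-map `φ` of the disk vanishes at `q`, then `f ↦ K_q · (f ∘ φ)` is bounded on `H²` by
the norm of `K_q`. -/
theorem exists_kernel_weightedComp {φ : 𝔻 → 𝔻} (hφ : IsHolo fun z => (φ z : ℂ)) {q : 𝔻}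
    (hq : φ q = 0) :
    ∃ T : HardySpace →L[ℂ] HardySpace,
      (∀ f : HardySpace, (T f : 𝔻 → ℂ) = weightedComp (kernel q) φ f) ∧
        ∀ f, ‖T f‖ ≤ ‖kernel q‖ * ‖f‖ := by
  obtain ⟨M, hM, hMle⟩ := exists_mul hφ zero_le_one fun z => (φ z).norm_lt_one.le
  have hpow (n : ℕ) (z : 𝔻) : (M ^ n) (kernel q) z = (φ z : ℂ) ^ n * kernel q z := by
    induction n with
    | zero => simp
    | succ n ih =>
      rw [pow_succ', mul_apply_eq_comp, hM, weightedComp, id, ih]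
      ring
  refine exists_clm_of_bound fun f => ?_
  -- Orthogonality holds since `⟪K_q, φ x⟫ = φ(q) x(q) = 0`. With the Taylor coefficients of `f`,
  -- the orbit series sums to `K_q · (f ∘ φ)`.
  obtain ⟨g, hg, hle⟩ := exists_hasSum_orbit (M := M) (fun x => by simpa using hMle x)
    (e := kernel q) (fun x => by simp [inner_kernel, hM, weightedComp, hq]) (norm_nonneg f)
    f.hasSum_norm_sq
  refine ⟨g, funext fun z => ?_, hle⟩
  refine (HasSum.apply hg z).unique ?_
  refine ((f.2.1.hasSum (φ z)).mul_left (kernel q z)).congr_fun fun n => ?_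
  rw [smul_apply, hpow]
  ring

theorem norm_kernel_sq (w : 𝔻) : ‖kernel w‖ ^ 2 = (1 - ‖(w : ℂ)‖ ^ 2)⁻¹ := by
  have h := inner_self_eq_norm_sq_to_K (𝕜 := ℂ) (kernel w)
  rw [inner_kernel, kernel_apply, conj_mul'] at h
  apply ofReal_injective
  push_cast
  exact h.symm

theorem kernel_zero_apply (z : 𝔻) : kernel 0 z = 1 := by simp [kernel_apply]

theorem norm_one_sub_ge (w z : 𝔻) : 1 - ‖(w : ℂ)‖ ≤ ‖1 - (w : ℂ) * z‖ := by
  have h := norm_sub_norm_le (1 : ℂ) (w * z)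
  rw [norm_one, norm_mul] at h
  nlinarith [z.norm_lt_one, norm_nonneg (w : ℂ)]

theorem one_sub_mul_ne_zero (w z : 𝔻) : 1 - (w : ℂ) * z ≠ 0 := by
  simpa using kernel_apply_ne_zero (star w) z

theorem isHolo_inv_one_sub (w : 𝔻) : IsHolo fun z => (1 - (w : ℂ) * z)⁻¹ := by
  have h := (kernel (star w)).2.1
  simpa [kernel] using h

theorem coe_phiP (p z : 𝔻) :
    (phiP p z : ℂ) = conj (p : ℂ) / p * ((p - z) / (1 - conj (p : ℂ) * z)) := rfl

theorem isHolo_of_differentiable {F : ℂ → ℂ} (hF : Differentiable ℂ F) :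
    IsHolo fun z => F z :=
  isHolo_of_eq hF.differentiableOn fun _ => rfl

theorem isHolo_phiP (p : 𝔻) : IsHolo fun z => (phiP p z : ℂ) := by
  have h := (isHolo_of_differentiable (F := fun z => conj (p : ℂ) / p * (p - z))
    (by fun_prop)).mul (isHolo_inv_one_sub (star p))
  simpa [coe_phiP, div_eq_mul_inv, mul_assoc] using h

theorem phiP_self (p : 𝔻) : phiP p p = 0 := by
  rw [← UnitDisc.coe_inj, coe_phiP]
  simp

theorem star_phiP_star (p z : 𝔻) : star (phiP p (star z)) = phiP (star p) z := by
  rw [← UnitDisc.coe_inj]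
  simp [coe_phiP]

theorem one_sub_mul_phiP {p : 𝔻} (hp : p ≠ 0) (z : 𝔻) :
    1 - (p : ℂ) * phiP p z = (1 - p * conj (p : ℂ)) / (1 - conj (p : ℂ) * z) := by
  have hp' : (p : ℂ) ≠ 0 := by simpa using hp
  have h := kernel_apply_ne_zero p z
  rw [coe_phiP]
  field_simp
  ring

/-- Because of the rotation `conj p / p`, `φ_p` is its own inverse only for real `p`; in general the
inverse is its conjugate by `star`, as the involutivity of `C` requires. -/
theorem phiP_star_phiP {p : 𝔻} (hp : p ≠ 0) (z : 𝔻) : phiP (star p) (phiP p z) = z := by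
  have hp' : (p : ℂ) ≠ 0 := by simpa using hp
  have hp'' : conj (p : ℂ) ≠ 0 := by simpa using hp
  have h := kernel_apply_ne_zero p z
  have h' : 1 - (p : ℂ) * conj (p : ℂ) ≠ 0 := by
    have := kernel_apply_ne_zero p p
    rwa [mul_comm] at this
  rw [← UnitDisc.coe_inj, coe_phiP, UnitDisc.coe_star, conj_conj, one_sub_mul_phiP hp, coe_phiP]
  field_simp
  ring

/-- An automorphism moves `φ(0) = a` to the origin: `φ = φ_{conj a} ∘ (φ_a ∘ φ)`, and each factor
has a known zero. -/
theorem exists_weightedComp {ψ : 𝔻 → ℂ} {φ : 𝔻 → 𝔻} (hψ : IsHolo ψ)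
    (hφ : IsHolo fun z => (φ z : ℂ)) {B : ℝ} (hB : ∀ z, ‖ψ z‖ ≤ B) :
    ∃ T : HardySpace →L[ℂ] HardySpace, ∀ f : HardySpace, (T f : 𝔻 → ℂ) = weightedComp ψ φ f := by
  obtain ⟨M, hM, -⟩ := exists_mul hψ ((norm_nonneg _).trans (hB 0)) hB
  by_cases h0 : φ 0 = 0
  · obtain ⟨T, hT, -⟩ := exists_kernel_weightedComp hφ h0
    refine ⟨M ∘L T, fun f => funext fun z => ?_⟩
    simp [hM, hT, weightedComp, kernel_zero_apply]
  · set a := φ 0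
    obtain ⟨T, hT, -⟩ := exists_kernel_weightedComp (φ := fun z => phiP a (φ z))
      ((isHolo_phiP a).comp hφ) (phiP_self a)
    obtain ⟨S, hS, -⟩ := exists_kernel_weightedComp (isHolo_phiP (star a)) (phiP_self (star a))
    -- Multiplication by `1 - a z` cancels the kernel `K_{conj a}` that `S` introduces.
    obtain ⟨N, hN, -⟩ := exists_mul (B := 2)
      (isHolo_of_differentiable (F := fun z => 1 - (a : ℂ) * z) (by fun_prop)) (by norm_num)
      fun z => (norm_sub_le _ _).trans (by
        rw [norm_one, ← UnitDisc.coe_mul]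
        linarith [(a * z).norm_lt_one])
    refine ⟨M ∘L T ∘L N ∘L S, fun f => funext fun z => ?_⟩
    have hne := one_sub_mul_ne_zero a (phiP a (φ z))
    simp [hM, hT, hN, hS, weightedComp, kernel_apply, phiP_star_phiP h0, hne]

/-! ### Conjugations -/

/-- Polarization: antilinearity turns `I • y` into `-I • C y`, which swaps the two imaginary terms
and so conjugates the inner product. -/
theorem inner_map_map_of_antilinear {H : Type*} [NormedAddCommGroup H] [InnerProductSpace ℂ H]
    (C : H →ₗᵢ⋆[ℂ] H) (x y : H) : inner ℂ (C x) (C y) = inner ℂ y x := by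
  have h1 : ‖C x + C y‖ = ‖x + y‖ := by rw [← map_add, C.norm_map]
  have h2 : ‖C x - C y‖ = ‖x - y‖ := by rw [← map_sub, C.norm_map]
  have h3 : ‖C x - I • C y‖ = ‖x + I • y‖ := by
    rw [← C.norm_map (x + I • y), map_add, map_smulₛₗ, conj_I, neg_smul, sub_eq_add_neg]
  have h4 : ‖C x + I • C y‖ = ‖x - I • y‖ := by
    rw [← C.norm_map (x - I • y), map_sub, map_smulₛₗ, conj_I, neg_smul, sub_neg_eq_add]
  rw [← inner_conj_symm y x, inner_eq_sum_norm_sq_div_four, inner_eq_sum_norm_sq_div_four x y]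
  simp only [RCLike.I_to_complex] at *
  rw [h1, h2, h3, h4]
  simp [map_ofNat]
  ring

theorem hasSum_conjJ (f : HardySpace) (z : 𝔻) :
    HasSum (fun n => conj (taylorCoeff f n) * (z : ℂ) ^ n) (conjJ f z) := by
  simpa [conjJ] using hasSum_conj'.2 (f.2.1.hasSum (star z))

theorem exists_conjJ (f : HardySpace) : ∃ g : HardySpace, (g : 𝔻 → ℂ) = conjJ f ∧ ‖g‖ = ‖f‖ := by
  have hm : MemHardy (conjJ f) := by
    rw [memHardy_iff (hasSum_conjJ f), memℓp_gen_iff (by norm_num)]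
    simpa using f.hasSum_norm_sq.summable
  refine ⟨⟨conjJ f, hm⟩, rfl, ?_⟩
  have h := hasSum_norm_sq ⟨conjJ f, hm⟩
  simp only [taylorCoeff_of_hasSum (hasSum_conjJ f), norm_conj] at h
  exact (pow_left_inj₀ (norm_nonneg _) (norm_nonneg _) two_ne_zero).1 (h.unique f.hasSum_norm_sq)

/-- A contractive weighted composition `C_{σ,τ}` for which `C_{σ,τ} J` is an involution on functions
gives a conjugation. -/
theorem exists_conjugation {σ : 𝔻 → ℂ} {τ : 𝔻 → 𝔻}
    (hτ : ∀ z, star (τ (star (τ z))) = z) (hσ : ∀ z, σ z * conj (σ (star (τ z))) = 1)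
    {U : HardySpace →L[ℂ] HardySpace} (hU : ∀ f : HardySpace, (U f : 𝔻 → ℂ) = weightedComp σ τ f)
    (hle : ∀ f, ‖U f‖ ≤ ‖f‖) :
    ∃ C : HardySpace →ₗᵢ⋆[ℂ] HardySpace, IsConjugation C ∧
      ∀ f : HardySpace, (C f : 𝔻 → ℂ) = weightedComp σ τ (conjJ f) := by
  choose J hJ hJn using exists_conjJ
  have hUJ (f : HardySpace) (z : 𝔻) : U (J f) z = σ z * conj (f (star (τ z))) := by
    rw [hU, weightedComp, hJ, conjJ]
  have hinv (f : HardySpace) : U (J (U (J f))) = f := by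
    refine ext fun z => ?_
    rw [hUJ, hUJ, hτ, map_mul, conj_conj, ← mul_assoc, hσ, one_mul]
  have hle' (f : HardySpace) : ‖U (J f)‖ ≤ ‖f‖ := (hle _).trans_eq (hJn f)
  let A : HardySpace →ₛₗ[starRingEnd ℂ] HardySpace :=
    { toFun f := U (J f)
      map_add' f g := ext fun z => by
        rw [add_apply, hUJ, hUJ, hUJ, add_apply, map_add, mul_add]
      map_smul' c f := ext fun z => by
        rw [smul_apply, hUJ, hUJ, smul_apply, map_mul]
        ring }
  -- Isometry: `‖f‖ = ‖C C f‖ ≤ ‖C f‖ ≤ ‖f‖`.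
  refine ⟨⟨A, fun f => (hle' f).antisymm ?_⟩, hinv, fun f => funext (hUJ f)⟩
  calc ‖f‖ = ‖U (J (U (J f)))‖ := by rw [hinv]
    _ ≤ ‖U (J f)‖ := hle' _

/-! ### The symmetric kernel equation and complex symmetry -/

/-- Clearing denominators, both sides are `b` over `1 - a₀ u - a₀ v + (a₀² - a₁) u v`. -/
theorem weightedComp_kernel_symm {ψ : 𝔻 → ℂ} {φ : 𝔻 → 𝔻} (h : IsJSymbolPair ψ φ) (u v : 𝔻) :
    ψ v * (1 - (u : ℂ) * φ v)⁻¹ = ψ u * (1 - (v : ℂ) * φ u)⁻¹ := by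
  obtain ⟨a₀, a₁, b, hψ, hφ⟩ := h
  have hu := one_sub_mul_ne_zero a₀ u
  have hv := one_sub_mul_ne_zero a₀ v
  rw [hψ, hψ, div_mul_eq_mul_div, div_mul_eq_mul_div, mul_div_assoc, mul_div_assoc,
    inv_div_left, inv_div_left, hφ, hφ]
  congr 2
  field_simp
  ring

/-- Setting `u = 0` determines `ψ`, with `ψ(0) ≠ 0`; then a single nonzero `u` gives an equation
linear in `φ(v)`. -/
theorem isJSymbolPair_of_symm {ψ : 𝔻 → ℂ} {φ : 𝔻 → 𝔻} (h0 : ψ ≠ 0)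
    (h : ∀ u v : 𝔻, ψ v * (1 - (u : ℂ) * φ v)⁻¹ = ψ u * (1 - (v : ℂ) * φ u)⁻¹) :
    IsJSymbolPair ψ φ := by
  have hψ (z : 𝔻) : ψ z = ψ 0 / (1 - (φ 0 : ℂ) * z) := by
    simpa [div_eq_mul_inv, mul_comm] using h 0 z
  have hb : ψ 0 ≠ 0 := fun hb => h0 (funext fun z => by rw [hψ, hb, zero_div]; rfl)
  let u : 𝔻 := UnitDisc.mk (1 / 2) (by norm_num)
  have hu : (u : ℂ) = 1 / 2 := rfl
  -- The value of `a₁` comes from solving the equation at `u = 1/2` for `φ(v)` and subtracting `a₀ =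
  -- φ(0)`.
  refine ⟨φ 0, 2 * (φ u * (1 - φ 0 * u) - φ 0) + (φ 0 : ℂ) ^ 2, ψ 0, hψ, fun v => ?_⟩
  have hv := one_sub_mul_ne_zero (φ 0) v
  have h1 := one_sub_mul_ne_zero (φ 0) u
  have h2 := one_sub_mul_ne_zero u (φ v)
  have h3 := one_sub_mul_ne_zero v (φ u)
  have key := h u v
  rw [hψ u, hψ v] at key
  field_simp at key ⊢
  rw [hu] at key ⊢
  linear_combination 2 * key

/-- With `C = C_{σ,τ} J` an involution, `C_{ψt,φt}` is complex symmetric when it comes from a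
symmetric pair by composing with `C_{σ,τ}`. -/
theorem weightedCompIsSymmetric_of_pair {σ : 𝔻 → ℂ} {τ : 𝔻 → 𝔻}
    (hτ : ∀ z, star (τ (star (τ z))) = z) (hσ : ∀ z, σ z * conj (σ (star (τ z))) = 1)
    {U : HardySpace →L[ℂ] HardySpace} (hU : ∀ f : HardySpace, (U f : 𝔻 → ℂ) = weightedComp σ τ f)
    {C : HardySpace →ₗᵢ⋆[ℂ] HardySpace} (hC : IsConjugation C)
    (hCf : ∀ f : HardySpace, (C f : 𝔻 → ℂ) = weightedComp σ τ (conjJ f))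
    {ψ ψt : 𝔻 → ℂ} {φ φt : 𝔻 → 𝔻} (h : IsJSymbolPair ψ φ)
    (hψt : ∀ z, ψt z = σ z * ψ (τ z)) (hφt : ∀ z, φt z = φ (τ z)) :
    WeightedCompIsSymmetric ψt φt C := by
  have hpair := h
  obtain ⟨a₀, a₁, b, hψ, hφ⟩ := h
  have hψh : IsHolo ψ := by
    have := (isHolo_of_differentiable (F := fun _ => b) (by fun_prop)).mul (isHolo_inv_one_sub a₀)
    convert this using 2 with z
    rw [hψ, div_eq_mul_inv]
  have hφh : IsHolo fun z => (φ z : ℂ) := by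
    have h1 := (isHolo_of_differentiable (F := fun z => a₀ * (1 - a₀ * z) + a₁ * z)
      (by fun_prop)).mul (isHolo_inv_one_sub a₀)
    convert h1 using 2 with z
    have := one_sub_mul_ne_zero a₀ z
    rw [hφ]
    field_simp
  have hB (z : 𝔻) : ‖ψ z‖ ≤ ‖b‖ / (1 - ‖(a₀ : ℂ)‖) := by
    rw [hψ, norm_div]
    exact div_le_div_of_nonneg_left (norm_nonneg _) (sub_pos.2 a₀.norm_lt_one)
      (norm_one_sub_ge a₀ z)
  obtain ⟨T, hT⟩ := exists_weightedComp hψh hφh hB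
  have hτ' (z : 𝔻) : τ (star (τ z)) = star z := by rw [← hτ z, star_star, hτ]
  -- This is `C U T = J T`: the symbols `σ` and `τ` cancel.
  have hUT (f : HardySpace) (z : 𝔻) : C ((U ∘L T) f) z = conj (T f (star z)) := by
    rw [hCf, weightedComp, conjJ, ContinuousLinearMap.comp_apply, hU, weightedComp, hτ', map_mul,
      ← mul_assoc, hσ, one_mul]
  refine ⟨U ∘L T, fun f => funext fun z => ?_, hC, fun f => ?_⟩
  · rw [ContinuousLinearMap.comp_apply, hU, weightedComp, hT, weightedComp, weightedComp, hψt, hφt,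
      mul_assoc]
  · have hK (w : 𝔻) : C ((U ∘L T) (kernel w)) = conj (ψ (star w)) • kernel (φ (star w)) := by
      refine ext fun z => ?_
      have := weightedComp_kernel_symm hpair (star w) (star z)
      rw [hUT, hT, weightedComp, smul_apply, kernel_apply, kernel_apply, ← UnitDisc.coe_star, this]
      simp [mul_comm]
    -- It remains to compare `(U T)* C f` with `C U T f`; pairing with `K_w` moves the adjoint onto
    -- the kernel, where `hK` applies.
    rw [← hC ((U ∘L T) f)]
    congr 1
    refine ext fun w => ?_
    rw [← inner_kernel, ContinuousLinearMap.adjoint_inner_right, ← hC ((U ∘L T) (kernel w)),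
      inner_map_map_of_antilinear, hK, hUT, hT, weightedComp, inner_smul_right, ← inner_conj_symm,
      inner_kernel, map_mul]

theorem exists_pair_of_weightedCompIsSymmetric {σ : 𝔻 → ℂ} {τ : 𝔻 → 𝔻}
    (hτ : ∀ z, star (τ (star (τ z))) = z) (hσ : ∀ z, σ z * conj (σ (star (τ z))) = 1)
    {C : HardySpace →ₗᵢ⋆[ℂ] HardySpace}
    (hCf : ∀ f : HardySpace, (C f : 𝔻 → ℂ) = weightedComp σ τ (conjJ f))
    {ψt : 𝔻 → ℂ} {φt : 𝔻 → 𝔻} (h0 : ψt ≠ 0) (h : WeightedCompIsSymmetric ψt φt C) :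
    ∃ (ψ : 𝔻 → ℂ) (φ : 𝔻 → 𝔻), IsJSymbolPair ψ φ ∧
      (∀ z, ψt z = σ z * ψ (τ z)) ∧ ∀ z, φt z = φ (τ z) := by
  obtain ⟨T, hT, hC, hsymm⟩ := h
  have hadj (f : HardySpace) : ContinuousLinearMap.adjoint T (C f) = C (T f) := by
    rw [← hsymm, hC]
  -- Both sides are the pairing `⟪T K_u, C K_v⟫`: on one side `C` is moved across, on the other `T`,
  -- using `T* C = C T`.
  have hker (u v : 𝔻) : C (T (kernel u)) v = C (T (kernel v)) u := by
    rw [← inner_kernel, ← inner_map_map_of_antilinear C, hC, ← ContinuousLinearMap.adjoint_inner_right,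
      hadj, inner_kernel]
  -- The map `star ∘ τ ∘ star` is inverse to `τ`, and `conj (σ (star z))` is the reciprocal of `σ`
  -- at the preimage of `z`.
  let ψ : 𝔻 → ℂ := fun z => conj (σ (star z)) * ψt (star (τ (star z)))
  let φ : 𝔻 → 𝔻 := fun z => φt (star (τ (star z)))
  have hψ (z : 𝔻) : ψt z = σ z * ψ (τ z) := by
    simp only [ψ, hτ]
    rw [← mul_assoc, hσ, one_mul]
  refine ⟨ψ, φ, isJSymbolPair_of_symm ?_ fun u v => ?_, hψ, fun z => by simp only [φ, hτ]⟩
  · rintro hz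
    exact h0 (funext fun z => by rw [hψ, hz]; simp)
  · have hval (u v : 𝔻) : conj (C (T (kernel (star u))) (star v))
        = ψ v * (1 - (u : ℂ) * φ v)⁻¹ := by
      rw [hCf, weightedComp, conjJ, hT, weightedComp, kernel_apply]
      simp [ψ, φ, mul_assoc]
    rw [← hval, ← hval, hker]

theorem exists_conjugation_and_characterization {σ : 𝔻 → ℂ} {τ : 𝔻 → 𝔻}
    (hτ : ∀ z, star (τ (star (τ z))) = z) (hσ : ∀ z, σ z * conj (σ (star (τ z))) = 1)
    {U : HardySpace →L[ℂ] HardySpace} (hU : ∀ f : HardySpace, (U f : 𝔻 → ℂ) = weightedComp σ τ f)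
    (hle : ∀ f, ‖U f‖ ≤ ‖f‖) :
    ∃ C : HardySpace →ₗᵢ⋆[ℂ] HardySpace, IsConjugation C ∧
      (∀ f : HardySpace, (C f : 𝔻 → ℂ) = weightedComp σ τ (conjJ f)) ∧
      ∀ (ψt : 𝔻 → ℂ) (φt : 𝔻 → 𝔻), IsHolo ψt → IsHolo (fun z => (φt z : ℂ)) →
        ((∃ (ψ : 𝔻 → ℂ) (φ : 𝔻 → 𝔻), IsJSymbolPair ψ φ ∧
            (∀ z, ψt z = σ z * ψ (τ z)) ∧ ∀ z, φt z = φ (τ z)) →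
          WeightedCompIsSymmetric ψt φt C) ∧
        (ψt ≠ 0 → WeightedCompIsSymmetric ψt φt C →
          ∃ (ψ : 𝔻 → ℂ) (φ : 𝔻 → 𝔻), IsJSymbolPair ψ φ ∧
            (∀ z, ψt z = σ z * ψ (τ z)) ∧ ∀ z, φt z = φ (τ z)) := by
  obtain ⟨C, hC, hCf⟩ := exists_conjugation hτ hσ hU hle
  exact ⟨C, hC, hCf, fun ψt φt _ _ =>
    ⟨fun ⟨ψ, φ, h, hψ, hφ⟩ => weightedCompIsSymmetric_of_pair hτ hσ hU hC hCf h hψ hφ,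
      exists_pair_of_weightedCompIsSymmetric hτ hσ hCf⟩⟩

/-! ### The normalized weight `ψ_p` and the two families -/

theorem psiP_eq (c : ℂ) (p z : 𝔻) :
    psiP c p z = c * (Real.sqrt (1 - ‖(p : ℂ)‖ ^ 2)) * kernel p z := by
  rw [psiP, kernel_apply, div_eq_mul_inv, mul_assoc]

theorem sqrt_mul_norm_kernel (p : 𝔻) : Real.sqrt (1 - ‖(p : ℂ)‖ ^ 2) * ‖kernel p‖ = 1 := by
  have h : 0 < 1 - ‖(p : ℂ)‖ ^ 2 := sub_pos.2 p.sq_norm_lt_one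
  rw [← pow_left_inj₀ (by positivity) zero_le_one two_ne_zero, mul_pow, Real.sq_sqrt h.le,
    norm_kernel_sq, mul_inv_cancel₀ h.ne', one_pow]

/-- By `one_sub_mul_phiP`, the second denominator is `(1 - |p|²) / (1 - conj p z)`, so everything
cancels down to `|c|² = 1`. -/
theorem psiP_mul_conj {p : 𝔻} (hp : p ≠ 0) {c : ℂ} (hc : ‖c‖ = 1) (z : 𝔻) :
    psiP c p z * conj (psiP c p (star (phiP p z))) = 1 := by
  have h : (0 : ℝ) < 1 - ‖(p : ℂ)‖ ^ 2 := sub_pos.2 p.sq_norm_lt_one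
  have hs : ((Real.sqrt (1 - ‖(p : ℂ)‖ ^ 2) : ℝ) : ℂ) ^ 2 = 1 - p * conj (p : ℂ) := by
    rw [← ofReal_pow, Real.sq_sqrt h.le, mul_conj']
    push_cast
    rfl
  have hc' : c * conj c = 1 := by rw [mul_conj', hc]; simp
  have h1 := kernel_apply_ne_zero p z
  have h2 : 1 - (p : ℂ) * conj (p : ℂ) ≠ 0 := by
    have := kernel_apply_ne_zero p p
    rwa [mul_comm] at this
  have h3 : conj (psiP c p (star (phiP p z))) = conj c *
      (Real.sqrt (1 - ‖(p : ℂ)‖ ^ 2) / (1 - p * phiP p z)) := by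
    simp [psiP]
  rw [h3, one_sub_mul_phiP hp, psiP]
  field_simp
  rw [hs, div_eq_iff (by rwa [mul_comm])]
  linear_combination (1 - (p : ℂ) * conj (p : ℂ)) * hc'

end HardySpace

open HardySpace in
theorem theorem2p5 :
    (∀ (p : 𝔻) (c : ℂ), p ≠ 0 → ‖c‖ = 1 →
      ∃ C : HardySpace →ₗᵢ⋆[ℂ] HardySpace, IsConjugation C ∧
        (∀ f : HardySpace, (C f : 𝔻 → ℂ) = weightedComp (psiP c p) (phiP p) (conjJ f)) ∧
        ∀ (ψt : 𝔻 → ℂ) (φt : 𝔻 → 𝔻), IsHolo ψt → IsHolo (fun z => (φt z : ℂ)) →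
          ((∃ (ψ : 𝔻 → ℂ) (φ : 𝔻 → 𝔻), IsJSymbolPair ψ φ ∧
              (∀ z, ψt z = psiP c p z * ψ (phiP p z)) ∧ ∀ z, φt z = φ (phiP p z)) →
            WeightedCompIsSymmetric ψt φt C) ∧
          (ψt ≠ 0 → WeightedCompIsSymmetric ψt φt C →
            ∃ (ψ : 𝔻 → ℂ) (φ : 𝔻 → 𝔻), IsJSymbolPair ψ φ ∧
              (∀ z, ψt z = psiP c p z * ψ (phiP p z)) ∧ ∀ z, φt z = φ (phiP p z))) ∧
    (∀ lam : Circle,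
      ∃ C : HardySpace →ₗᵢ⋆[ℂ] HardySpace, IsConjugation C ∧
        (∀ f : HardySpace,
          (C f : 𝔻 → ℂ) = weightedComp (fun _ => 1) (fun z => lam • z) (conjJ f)) ∧
        ∀ (ψt : 𝔻 → ℂ) (φt : 𝔻 → 𝔻), IsHolo ψt → IsHolo (fun z => (φt z : ℂ)) →
          ((∃ (ψ : 𝔻 → ℂ) (φ : 𝔻 → 𝔻), IsJSymbolPair ψ φ ∧
              (∀ z, ψt z = ψ (lam • z)) ∧ ∀ z, φt z = φ (lam • z)) →
            WeightedCompIsSymmetric ψt φt C) ∧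
          (ψt ≠ 0 → WeightedCompIsSymmetric ψt φt C →
            ∃ (ψ : 𝔻 → ℂ) (φ : 𝔻 → 𝔻), IsJSymbolPair ψ φ ∧
              (∀ z, ψt z = ψ (lam • z)) ∧ ∀ z, φt z = φ (lam • z))) := by
  refine ⟨fun p c hp hc => ?_, fun lam => ?_⟩
  · obtain ⟨T, hT, hle⟩ := exists_kernel_weightedComp (isHolo_phiP p) (phiP_self p)
    refine exists_conjugation_and_characterization (fun z => ?_) (psiP_mul_conj hp hc)
      -- The scalar has modulus `1 / ‖K_p‖`, exactly what makes `U` a contraction.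
      (U := (c * (Real.sqrt (1 - ‖(p : ℂ)‖ ^ 2) : ℝ)) • T) (fun f => funext fun z => ?_)
      fun f => ?_
    · rw [star_phiP_star, phiP_star_phiP hp]
    · rw [_root_.smul_apply, smul_apply, hT, weightedComp, weightedComp, psiP_eq]
      ring
    · rw [_root_.smul_apply, norm_smul, norm_mul, hc, one_mul, norm_real,
        Real.norm_of_nonneg (Real.sqrt_nonneg _)]
      calc _ ≤ _ := mul_le_mul_of_nonneg_left (hle f) (Real.sqrt_nonneg _)
        _ = ‖f‖ := by rw [← mul_assoc, sqrt_mul_norm_kernel, one_mul]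
  · have hholo : IsHolo fun z => ((lam • z : 𝔻) : ℂ) :=
      isHolo_of_differentiable (F := fun z => (lam : ℂ) * z) (by fun_prop)
    -- A rotation fixes the origin, and `K_0 = 1` has norm one, so no weight is needed.
    obtain ⟨T, hT, hle⟩ := exists_kernel_weightedComp (q := 0) hholo
      (by rw [← UnitDisc.coe_inj]; simp)
    have hone : kernel 0 = (fun _ => 1 : 𝔻 → ℂ) := funext kernel_zero_apply
    have hnorm : ‖kernel 0‖ = 1 := by simpa using sqrt_mul_norm_kernel 0
    simp_rw [hnorm, one_mul] at hle
    rw [hone] at hT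
    simpa only [one_mul] using exists_conjugation_and_characterization (fun z => by
      rw [← UnitDisc.coe_inj]
      simp [← mul_assoc, conj_mul', Circle.norm_coe]) (fun z => by simp) hT hle
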